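/- Let $R$ be a Dedekind domain of characteristic $0$ and let $\pi\colon S\to \mathrm{Spec}(R)$ be a smooth morphism of finite type with $S$ an integral scheme. Let $B$ be a Dedekind domain containing $R$, with field of fractions $K$, let $\eta$ be the generic point of $\mathrm{Spec}(B)$, and let $\iota\colon \mathrm{Spec}(B)\to S$ be a morphism of schemes over $R$. Let $f$ be a non-zero rational function on $S$ with divisor $\mathrm{div}(f)=(f)_0-(f)_\infty=\sum_i m_iD_i$, where the $m_i$ are non-zero integers and the $D_i$ are distinct irreducible reduced effective divisors, and let $Z\subseteq S$ be the reduced closed subscheme supported on $\mathrm{div}(f)_0$, i.e. on $\bigcup_{m_i>0}D_i$. Assume that $\mathrm{div}(f)$ meets the image of $\iota$ properly, i.e. that no $D_i$ contains the image of $\iota$. Then $f$ is regular at $\iota(\eta)$, so that $f(\eta):=\iota^*f$ is a well-defined element of $K$. Moreover, let $\mathfrak p$ be a non-zero prime ideal of $B$, let $x=\iota(\mathfrak p)$, and suppose that $\mathrm{val}_{\mathfrak p}(f(\eta))=\alpha$ with $\alpha$ a positive integer, where $\mathrm{val}_{\mathfrak p}$ is the normalized $\mathfrak p$-adic valuation on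 $K$. Then $d:=\max\{m_i : x\in D_i\}$ exists and $d>0$; the integer $a:=\lceil \alpha/d\rceil$ is positive; and the composite $\mathrm{Spec}(B/\mathfrak p^{a})\to \mathrm{Spec}(B)\xrightarrow{\ \iota\ } S$ factors through the closed immersion $Z\hookrightarrow S$. -/

import Mathlib

open AlgebraicGeometry CategoryTheory

universe u

namespace DivisorReduction

/-- A scheme that is smooth over the spectrum of a Noetherian ring is locally Noetherian. -/
theorem isLocallyNoetherian_of_smooth {R : Type u} [CommRing R] [IsNoetherianRing R]
    {S : Scheme.{u}} (π : S ⟶ Spec (CommRingCat.of R)) [Smooth π] : IsLocallyNoetherian S :=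
  LocallyOfFiniteType.isLocallyNoetherian π

section Divisor

variable {S : Scheme.{u}} [IsIntegral S] [IsLocallyNoetherian S]

/-- The components of the divisor of the rational function `f`, each given by its generic point:
the points `z` of codimension one at which `f` has non-zero order. The component is the
irreducible reduced divisor `closure {z}`, and its multiplicity in the divisor is
`Scheme.ord f z`. -/
def divComponents (f : S.functionField) : Set S :=
  {z | Order.coheight z = 1 ∧ Scheme.ord f z ≠ 0}

/-- The divisor of `f` meets the image of `j` properly: no component of the divisor
contains the whole image. -/
def DivMeetsProperly {X : Scheme.{u}} (f : S.functionField) (j : X ⟶ S) : Prop :=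
  ∀ z ∈ divComponents f, ¬ Set.range j ⊆ closure {z}

/-- The multiplicities of the components of the divisor of `f` that pass through `x`. -/
def multiplicitiesAt (f : S.functionField) (x : S) : Set ℤ :=
  {m | ∃ z ∈ divComponents f, x ∈ closure {z} ∧ Scheme.ord f z = m}

/-- The support of the divisor of zeros of `f`: the union of the (locally finitely many)
components of positive multiplicity, that is, the closure of the set of their generic points. -/
def zeroDivisorSupport (f : S.functionField) : TopologicalSpace.Closeds S :=
  TopologicalSpace.Closeds.closure {z | z ∈ divComponents f ∧ 0 < Scheme.ord f z}

/-- The ideal sheaf of the reduced closed subscheme supported on the divisor of zeros. -/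
noncomputable def zeroDivisorIdeal (f : S.functionField) : S.IdealSheafData :=
  Scheme.IdealSheafData.vanishingIdeal (zeroDivisorSupport f)

end Divisor

/-- The rational function `f` lies in the local ring of `S` at `s`. -/
def IsRegularAt {S : Scheme.{u}} [IsIntegral S] (f : S.functionField) (s : S) : Prop :=
  ∃ g : S.presheaf.stalk s, algebraMap (S.presheaf.stalk s) S.functionField g = f

/-- The pullback along `j : X ⟶ S` of a rational function `f` on `S` that is regular at the
image of the generic point of `X`: the germ of `f` there is sent to the function field of `X` by
the map of local rings. -/
noncomputable def pullbackFunction {X S : Scheme.{u}} [IsIntegral X] [IsIntegral S] (j : X ⟶ S)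
    (f : S.functionField) (h : IsRegularAt f (j (genericPoint X))) : X.functionField :=
  j.stalkMap (genericPoint X) h.choose

/-- The function field of `Spec B` as an algebra over `B`. -/
noncomputable instance algebraFunctionFieldSpec (B : Type u) [CommRing B] [IsDomain B] :
    Algebra B (Spec (CommRingCat.of B)).functionField :=
  instAlgebraCarrierFunctionFieldSpec (CommRingCat.of B)

/-- The function field of `Spec B` is the field of fractions of `B`. -/
instance isFractionRing_functionFieldSpec (B : Type u) [CommRing B] [IsDomain B] :
    IsFractionRing B (Spec (CommRingCat.of B)).functionField :=
  functionField_isFractionRing_of_affine (CommRingCat.of B)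

/-- The map `Spec (B / I) ⟶ Spec B`. -/
noncomputable def specQuotient {B : Type u} [CommRing B] (I : Ideal B) :
    Spec (CommRingCat.of (B ⧸ I)) ⟶ Spec (CommRingCat.of B) :=
  Spec.map (CommRingCat.ofHom (Ideal.Quotient.mk I))

/-- The germ in the definition of `pullbackFunction` is unique. -/
theorem pullbackFunction_eq {X S : Scheme.{u}} [IsIntegral X] [IsIntegral S] (j : X ⟶ S)
    (f : S.functionField) (h : IsRegularAt f (j (genericPoint X)))
    (g : S.presheaf.stalk (j (genericPoint X)))
    (hg : algebraMap (S.presheaf.stalk (j (genericPoint X))) S.functionField g = f) :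
    pullbackFunction j f h = j.stalkMap (genericPoint X) g := by
  have : h.choose = g :=
    IsFractionRing.injective (S.presheaf.stalk (j (genericPoint X))) S.functionField
      (h.choose_spec.trans hg.symm)
  rw [pullbackFunction, this]

end DivisorReduction

/-! ### Normality passes up smooth maps. -/

section CommutativeAlgebra

open TensorProduct nonZeroDivisors

/-! Smoothness over the normal ring `R` makes `S` normal (`IsIntegrallyClosed.of_smooth`), and on a
locally Noetherian normal integral scheme a nonzero rational function with non-negative order along
every prime divisor through a point is regular there (`isRegularAt_of_forall_specializes`). This
principle is applied three times. A component through `ι(η)` would contain the whole image of `ι`,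
so `f` is regular at `ι(η)`. If no zero component passed through `x`, then `f⁻¹` would be regular at
`x`, contradicting `α > 0`. Finally, let `d` be the largest multiplicity at `x` and `s` a section
vanishing on `Z` with nonzero germ at `x`: then `s ^ d / f` is regular at `x`
(`isRegularAt_pow_mul_inv`).

Pulling back `s ^ d = f * (s ^ d / f)` gives `d * val s ≥ α`, hence `val s ≥ ⌈α / d⌉ = a`, so `s`
dies in `B / p ^ a`. Thus the ideal of `Z` lies in the kernel (`zeroDivisorIdeal_le_ker`), which is
the factorization. -/

theorem MvPolynomial.isIntegrallyClosed_fin (R : Type*) [CommRing R] [IsDomain R]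
    [IsIntegrallyClosed R] (n : ℕ) : IsIntegrallyClosed (MvPolynomial (Fin n) R) := by
  induction n with
  | zero => exact .of_equiv (MvPolynomial.isEmptyAlgEquiv R (Fin 0)).symm.toRingEquiv
  | succ n ih => exact .of_equiv (MvPolynomial.finSuccEquiv R n).symm.toRingEquiv

/-- A domain that is étale over an integrally closed domain is integrally closed. -/
theorem IsIntegrallyClosed.of_etale (P C : Type*) [CommRing P] [IsDomain P]
    [IsIntegrallyClosed P] [CommRing C] [IsDomain C] [Algebra P C] [Algebra.Etale P C] :
    IsIntegrallyClosed C := by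
  let L := FractionRing P
  let M := Algebra.algebraMapSubmonoid C P⁰
  have hM : M ≤ C⁰ := by
    rintro _ ⟨p, hp, rfl⟩
    exact mem_nonZeroDivisors_of_ne_zero <|
      (map_ne_zero_iff _ (FaithfulSMul.algebraMap_injective P C)).mpr (nonZeroDivisors.ne_zero hp)
  have hloc : IsLocalization M (C ⊗[P] L) := inferInstance
  have : IsDomain (C ⊗[P] L) := IsLocalization.isDomain_of_le_nonZeroDivisors _ hM
  have : IsDomain (L ⊗[P] C) := (Algebra.TensorProduct.comm P L C).toMulEquiv.isDomain
  -- An étale algebra over a field is finite, and a domain finite over a field is a field; so `C ⊗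
  -- L` is the fraction field of `C`.
  have : Module.Finite L (L ⊗[P] C) := Algebra.FormallyUnramified.finite_of_free _ _
  have hfield : IsField (L ⊗[P] C) :=
    isField_of_isIntegral_of_isField' (R := L) (Field.toIsField L)
  let _ : Field (C ⊗[P] L) :=
    ((Algebra.TensorProduct.comm P C L).toMulEquiv.isField hfield).toField
  have : FaithfulSMul C (C ⊗[P] L) :=
    (faithfulSMul_iff_algebraMap_injective _ _).mpr (IsLocalization.injective _ hM)
  have : IsFractionRing C (C ⊗[P] L) := by
    refine IsFractionRing.of_field _ _ fun z ↦ ?_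
    obtain ⟨x, s, rfl⟩ := IsLocalization.exists_mk'_eq M z
    refine ⟨x, s, ?_⟩
    rw [eq_div_iff, IsLocalization.mk'_spec]
    exact (IsLocalization.map_units (C ⊗[P] L) s).ne_zero
  refine (isIntegrallyClosed_iff (C ⊗[P] L)).mpr fun {z} hz ↦ ?_
  -- Integral closure commutes with smooth base change, so `z` comes from `C ⊗ (integral closure of
  -- P in L)`, and that closure is `P`.
  obtain ⟨w, hw⟩ :=
    (TensorProduct.toIntegralClosure_bijective_of_smooth (R := P) (S := C) (B := L)).2 ⟨z, hz⟩
  obtain rfl : (TensorProduct.toIntegralClosure P C L w : C ⊗[P] L) = z := congr_arg Subtype.val hw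
  clear hw hz
  induction w with
  | zero => exact ⟨0, by simp⟩
  | add a b ha hb =>
    obtain ⟨a', ha⟩ := ha
    obtain ⟨b', hb⟩ := hb
    exact ⟨a' + b', by simp [ha, hb]⟩
  | tmul c y =>
    obtain ⟨p, hp⟩ := IsIntegrallyClosed.algebraMap_eq_of_integral y.2
    refine ⟨c * algebraMap P C p, ?_⟩
    have : (TensorProduct.toIntegralClosure P C L (c ⊗ₜ y) : C ⊗[P] L) = c ⊗ₜ (y : L) := rfl
    rw [this, ← hp, Algebra.TensorProduct.algebraMap_apply, Algebra.algebraMap_self_apply,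
      Algebra.algebraMap_eq_smul_one p, Algebra.algebraMap_eq_smul_one p,
      TensorProduct.tmul_smul, mul_smul_comm, mul_one, TensorProduct.smul_tmul']

/-- A domain that is smooth over an integrally closed domain is integrally closed. -/
theorem IsIntegrallyClosed.of_smooth (R C : Type*) [CommRing R] [IsDomain R]
    [IsIntegrallyClosed R] [CommRing C] [IsDomain C] [Algebra R C] [Algebra.Smooth R C] :
    IsIntegrallyClosed C := by
  refine IsIntegrallyClosed.of_localization_maximal fun m _ _ ↦ ?_
  -- Near `m`, a smooth algebra is étale over a polynomial ring, which is normal.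
  obtain ⟨c, hc, n, _, _, _⟩ :=
    Algebra.IsSmoothAt.exists_isStandardEtale_mvPolynomial (R := R) (p := m)
  have hc0 : c ≠ 0 := fun h ↦ hc (h ▸ m.zero_mem)
  have := MvPolynomial.isIntegrallyClosed_fin R n
  have : IsDomain (Localization.Away c) :=
    IsLocalization.isDomain_of_le_nonZeroDivisors _ (powers_le_nonZeroDivisors_of_noZeroDivisors hc0)
  have : IsIntegrallyClosed (Localization.Away c) :=
    .of_etale (MvPolynomial (Fin n) R) (Localization.Away c)
  have hle : Submonoid.powers c ≤ m.primeCompl := Submonoid.powers_le.mpr hc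
  let _ : Algebra (Localization.Away c) (Localization.AtPrime m) :=
    IsLocalization.localizationAlgebraOfSubmonoidLe _ _ _ _ hle
  have := IsLocalization.localization_isScalarTower_of_submonoid_le
    (Localization.Away c) (Localization.AtPrime m) _ _ hle
  have := IsLocalization.isLocalization_of_submonoid_le
    (Localization.Away c) (Localization.AtPrime m) _ _ hle
  refine isIntegrallyClosed_of_isLocalization (R := Localization.Away c) _
    (m.primeCompl.map (algebraMap C (Localization.Away c))) ?_
  rintro _ ⟨s, hs, rfl⟩
  rw [mem_nonZeroDivisors_iff_ne_zero]
  refine (map_ne_zero_iff _ (IsLocalization.injective _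
    (powers_le_nonZeroDivisors_of_noZeroDivisors hc0))).mpr ?_
  rintro rfl
  exact hs m.zero_mem

/-! ### Regularity in codimension one implies regularity. -/

/-- The ideal of denominators of an element of an algebra. -/
def Ideal.denominators (A : Type*) {K : Type*} [CommRing A] [CommRing K] [Algebra A K] (y : K) :
    Ideal A :=
  Submodule.comap (LinearMap.toSpanSingleton A K y) (LinearMap.range (Algebra.linearMap A K))

theorem Ideal.mem_denominators {A K : Type*} [CommRing A] [CommRing K] [Algebra A K] {y : K}
    {s : A} : s ∈ Ideal.denominators A y ↔ ∃ a, algebraMap A K a = algebraMap A K s * y := by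
  simp [Ideal.denominators, Algebra.smul_def]

/-- In a Noetherian integrally closed domain, a prime ideal that is the ideal of denominators of
a fraction has height one. -/
theorem Ideal.height_eq_one_of_eq_denominators {A K : Type*} [CommRing A] [IsDomain A]
    [IsNoetherianRing A] [IsIntegrallyClosed A] [Field K] [Algebra A K] [IsFractionRing A K]
    (q : Ideal A) [hq : q.IsPrime] (y : K) (hy : q = Ideal.denominators A y) : q.height = 1 := by
  let Q := Localization.AtPrime q
  have hqc := q.primeCompl_le_nonZeroDivisors
  let _ : Algebra Q K := IsLocalization.localizationAlgebraOfSubmonoidLe Q K _ _ hqc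
  have : IsScalarTower A Q K :=
    IsLocalization.localization_isScalarTower_of_submonoid_le Q K _ _ hqc
  have : IsFractionRing Q K := .isFractionRing_of_isDomain_of_isLocalization q.primeCompl Q K
  have : IsNoetherianRing Q := IsLocalization.isNoetherianRing q.primeCompl Q inferInstance
  have : IsIntegrallyClosed Q := isIntegrallyClosed_of_isLocalization _ _ hqc
  have hnot : ¬ ∃ t : Q, algebraMap Q K t = y := by
    rintro ⟨t, ht⟩
    obtain ⟨a, s, rfl⟩ := IsLocalization.exists_mk'_eq q.primeCompl t
    refine s.2 (hy.ge (Ideal.mem_denominators.mpr ⟨a, ?_⟩))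
    rw [← ht, IsScalarTower.algebraMap_apply A Q K, IsScalarTower.algebraMap_apply A Q K,
      ← map_mul, mul_comm, IsLocalization.mk'_spec]
  have hmul (r : Q) (hr : r ∈ IsLocalRing.maximalIdeal Q) :
      ∃ t : Q, algebraMap Q K t = algebraMap Q K r * y := by
    rw [← Localization.AtPrime.map_eq_maximalIdeal] at hr
    obtain ⟨⟨⟨a, ha⟩, s⟩, has⟩ := (IsLocalization.mem_map_algebraMap_iff q.primeCompl Q).mp hr
    rw [hy, Ideal.mem_denominators] at ha
    obtain ⟨b, hb⟩ := ha
    refine ⟨IsLocalization.mk' Q b s, ?_⟩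
    have hs : algebraMap A K s ≠ 0 :=
      IsFractionRing.to_map_ne_zero_of_mem_nonZeroDivisors (hqc s.2)
    apply mul_right_cancel₀ hs
    have h1 := congr_arg (algebraMap Q K) (IsLocalization.mk'_spec Q b s)
    have h2 := congr_arg (algebraMap Q K) has
    simp only [map_mul, ← IsScalarTower.algebraMap_apply] at h1 h2
    rw [h1, hb, mul_right_comm, h2]
  have hy0 : y ≠ 0 := by
    rintro rfl
    exact hnot ⟨0, map_zero _⟩
  -- Otherwise `y` maps the maximal ideal into itself, and the determinant trick makes `y` integral
  -- over `Q`, hence in `Q`. The trick needs a nonzero ideal; if it were zero, a denominator of `y`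
  -- would be a nonzero element of `q = ⊥`.
  obtain ⟨r, hr, t, ht, hunit⟩ : ∃ r ∈ IsLocalRing.maximalIdeal Q, ∃ t : Q,
      algebraMap Q K t = algebraMap Q K r * y ∧ IsUnit t := by
    by_contra! hcon
    refine hnot (IsIntegrallyClosed.algebraMap_eq_of_integral (R := Q) ?_)
    by_cases hbot : IsLocalRing.maximalIdeal Q = ⊥
    · exfalso
      have hqbot : q = ⊥ := by
        rw [← Localization.AtPrime.under_maximalIdeal (I := q), hbot]
        exact (RingHom.injective_iff_ker_eq_bot _).mp (IsLocalization.injective Q hqc)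
      obtain ⟨a, b, hb, rfl⟩ := IsFractionRing.div_surjective (A := A) y
      have hbK := IsFractionRing.to_map_ne_zero_of_mem_nonZeroDivisors (K := K) hb
      have hbq : b ∈ q := by
        rw [hy, Ideal.mem_denominators]
        exact ⟨a, (mul_div_cancel₀ _ hbK).symm⟩
      rw [hqbot] at hbq
      exact nonZeroDivisors.ne_zero hb hbq
    refine isIntegral_of_smul_mem_submodule
      (Submodule.map (Algebra.linearMap Q K) (IsLocalRing.maximalIdeal Q)) ?_ ?_ y ?_
    · obtain ⟨a, ha, ha0⟩ := Submodule.exists_mem_ne_zero_of_ne_bot hbot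
      exact (Submodule.ne_bot_iff _).mpr
        ⟨_, ⟨a, ha, rfl⟩, (map_ne_zero_iff _ (IsFractionRing.injective Q K)).mpr ha0⟩
    · exact (IsNoetherian.noetherian _).map _
    · rintro _ ⟨a, ha, rfl⟩
      obtain ⟨t, ht⟩ := hmul a ha
      refine ⟨t, (IsLocalRing.mem_maximalIdeal t).mpr (hcon a ha t ht), ?_⟩
      simp only [Algebra.linearMap_apply, smul_eq_mul]
      rw [ht, mul_comm]
  have hr0 : r ≠ 0 := by
    rintro rfl
    rw [map_zero, zero_mul, map_eq_zero_iff _ (IsFractionRing.injective Q K)] at ht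
    exact not_isUnit_zero (ht ▸ hunit)
  -- Since `r * y` is a unit, `a = (a * y) * (r * y)⁻¹ * r` for every `a` in the maximal ideal.
  have hprin : (IsLocalRing.maximalIdeal Q).IsPrincipal := by
    refine ⟨r, le_antisymm (fun a ha ↦ ?_) ((Ideal.span_singleton_le_iff_mem _).mpr hr)⟩
    obtain ⟨b, hb⟩ := hmul a ha
    obtain ⟨u, rfl⟩ := hunit
    refine Ideal.mem_span_singleton'.mpr ⟨b * ↑u⁻¹, ?_⟩
    have hab : a * u = b * r := by
      apply IsFractionRing.injective Q K
      rw [map_mul, map_mul, hb, ht]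
      ring
    rw [mul_right_comm, ← hab, mul_assoc, Units.mul_inv, mul_one]
  have hnf : ¬ IsField Q := fun h ↦ hr0 <| by
    have := IsLocalRing.isField_iff_maximalIdeal_eq.mp h
    rw [this] at hr
    exact hr
  have : IsDiscreteValuationRing Q := ((IsDiscreteValuationRing.TFAE Q hnf).out 4 0).mp hprin
  have h := IsLocalization.AtPrime.ringKrullDim_eq_height q Q
  rw [IsDiscreteValuationRing.ringKrullDim_eq_one] at h
  exact_mod_cast h.symm

/-- In a Noetherian integrally closed domain, a fraction that is regular at all height one primes
contained in a prime `p` is regular at `p`. -/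
theorem exists_notMem_denominators_of_height_one {A K : Type*} [CommRing A] [IsDomain A]
    [IsNoetherianRing A] [IsIntegrallyClosed A] [Field K] [Algebra A K] [IsFractionRing A K]
    (p : Ideal A) [p.IsPrime] (y : K)
    (h : ∀ q : Ideal A, q.IsPrime → q.height = 1 → q ≤ p → ∃ s ∉ q, s ∈ Ideal.denominators A y) :
    ∃ s ∉ p, s ∈ Ideal.denominators A y := by
  by_contra! hcon
  have hle : Ideal.denominators A y ≤ p := fun s hs ↦ by_contra fun hsp ↦ hcon s hsp hs
  obtain ⟨q, hq, hqp⟩ := Ideal.exists_minimalPrimes_le hle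
  have hqprime : q.IsPrime := hq.1.1
  -- Viewed as a colon ideal, the denominators have minimal primes that are again colons, here the
  -- denominators of a multiple `c * y`.
  have hone : (Ideal.denominators A y).colon {(1 : A)} = Ideal.denominators A y := by
    ext s
    rw [Submodule.mem_colon_singleton, smul_eq_mul, mul_one]
  obtain ⟨c, hc⟩ : ∃ c : A, q = (Ideal.denominators A y).colon {c} :=
    Submodule.exists_eq_colon_of_mem_minimalPrimes (hone.symm ▸ hq)
  have hqc : q = Ideal.denominators A (algebraMap A K c * y) := by
    rw [hc]
    ext s
    rw [Submodule.mem_colon_singleton, smul_eq_mul, Ideal.mem_denominators, Ideal.mem_denominators,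
      map_mul, mul_assoc]
  obtain ⟨s, hs, hsy⟩ := h q hqprime (q.height_eq_one_of_eq_denominators _ hqc) hqp
  refine hs (hqc.ge (Ideal.mem_denominators.mpr ?_))
  obtain ⟨a, ha⟩ := Ideal.mem_denominators.mp hsy
  exact ⟨c * a, by rw [map_mul, ha]; ring⟩

end CommutativeAlgebra
-- Orders and regularity of rational functions on a scheme.
namespace DivisorReduction

/-- Both numbers are the Krull dimension of the local ring at `x`. -/
theorem height_primeIdealOf {S : Scheme.{u}} {U : S.Opens} (hU : IsAffineOpen U) (x : U) :
    ((hU.primeIdealOf x).asIdeal.height : WithBot ℕ∞) = Order.coheight x.1 := by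
  have := hU.isLocalization_stalk x
  let _ := TopCat.Presheaf.algebra_section_stalk S.presheaf x
  rw [← ringKrullDim_stalk_eq_coheight,
    IsLocalization.AtPrime.ringKrullDim_eq_height (hU.primeIdealOf x).asIdeal]

section IntegralScheme

variable {S : Scheme.{u}} [IsIntegral S]

theorem isRegularAt_iff_denominators {U : S.Opens} (hU : IsAffineOpen U) [Nonempty U] (x : U)
    (f : S.functionField) :
    IsRegularAt f x.1 ↔
      ∃ s ∉ (hU.primeIdealOf x).asIdeal, s ∈ Ideal.denominators Γ(S, U) f := by
  have := hU.isLocalization_stalk x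
  let _ := TopCat.Presheaf.algebra_section_stalk S.presheaf x
  have := functionField_isScalarTower S U x
  constructor
  · rintro ⟨g, hg⟩
    obtain ⟨a, s, rfl⟩ := IsLocalization.exists_mk'_eq (hU.primeIdealOf x).asIdeal.primeCompl g
    refine ⟨s, s.2, Ideal.mem_denominators.mpr ⟨a, ?_⟩⟩
    rw [← hg, IsScalarTower.algebraMap_apply Γ(S, U) (S.presheaf.stalk x.1) S.functionField a,
      IsScalarTower.algebraMap_apply Γ(S, U) (S.presheaf.stalk x.1) S.functionField s, ← map_mul,
      mul_comm, IsLocalization.mk'_spec]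
  · rintro ⟨s, hs, hsf⟩
    obtain ⟨a, ha⟩ := Ideal.mem_denominators.mp hsf
    let s' : (hU.primeIdealOf x).asIdeal.primeCompl := ⟨s, hs⟩
    refine ⟨IsLocalization.mk' _ a s', ?_⟩
    have hs0 : algebraMap (S.presheaf.stalk x.1) S.functionField (algebraMap _ _ s) ≠ 0 :=
      ((IsLocalization.map_units (S.presheaf.stalk x.1) s').map
        (algebraMap (S.presheaf.stalk x.1) S.functionField)).ne_zero
    apply mul_right_cancel₀ hs0
    rw [← map_mul, IsLocalization.mk'_spec (S.presheaf.stalk x.1) a s',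
      ← IsScalarTower.algebraMap_apply, ← IsScalarTower.algebraMap_apply, ha, mul_comm]

theorem isIntegrallyClosed_stalk_of_isAffineOpen {U : S.Opens} (hU : IsAffineOpen U)
    [Nonempty U] [IsIntegrallyClosed Γ(S, U)] (x : U) :
    IsIntegrallyClosed (S.presheaf.stalk x.1) := by
  have := hU.isLocalization_stalk x
  let _ := TopCat.Presheaf.algebra_section_stalk S.presheaf x
  exact isIntegrallyClosed_of_isLocalization _ _
    (hU.primeIdealOf x).asIdeal.primeCompl_le_nonZeroDivisors

theorem isIntegrallyClosed_of_smooth {R : Type u} [CommRing R] [IsDomain R]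
    [IsIntegrallyClosed R] (π : S ⟶ Spec (CommRingCat.of R)) [Smooth π]
    {U : S.Opens} (hU : IsAffineOpen U) [Nonempty U] : IsIntegrallyClosed Γ(S, U) := by
  have h := Smooth.smooth_appLE π (isAffineOpen_top _) hU le_top
  let e := (Scheme.ΓSpecIso (CommRingCat.of R)).symm.commRingCatIsoToRingEquiv
  have : IsDomain Γ(Spec (CommRingCat.of R), ⊤) := e.symm.toMulEquiv.isDomain
  have : IsIntegrallyClosed Γ(Spec (CommRingCat.of R), ⊤) := .of_equiv e
  algebraize [(π.appLE ⊤ U le_top).hom]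
  exact .of_smooth Γ(Spec (CommRingCat.of R), ⊤) Γ(S, U)

variable [IsLocallyNoetherian S]

theorem isDiscreteValuationRing_stalk (z : S) (hz : Order.coheight z = 1)
    [IsIntegrallyClosed (S.presheaf.stalk z)] :
    IsDiscreteValuationRing (S.presheaf.stalk z) := by
  have hdim := ringKrullDim_stalk_eq_coheight z
  rw [hz] at hdim
  have hle : Ring.KrullDimLE 1 (S.presheaf.stalk z) := krullDimLE_of_coheight_le hz.le
  have hnf : ¬ IsField (S.presheaf.stalk z) := fun h ↦ by
    rw [ringKrullDim_eq_zero_of_isField h] at hdim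
    exact absurd hdim (by norm_num)
  refine ((IsDiscreteValuationRing.TFAE _ hnf).out 2 0).mp ?_
  have hdim' : Ring.DimensionLEOne (S.presheaf.stalk z) :=
    ⟨fun {I} hI hIp ↦ Ring.krullDimLE_one_iff_of_isPrime_bot.mp hle I hI hIp⟩
  exact { (inferInstance : IsIntegrallyClosed (S.presheaf.stalk z)), hdim' with }

theorem isRegularAt_of_ord_nonneg {f : S.functionField} (hf : f ≠ 0) {z : S}
    (hz : Order.coheight z = 1) [IsIntegrallyClosed (S.presheaf.stalk z)]
    (h : 0 ≤ Scheme.ord f z) : IsRegularAt f z := by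
  have := isDiscreteValuationRing_stalk z hz
  have h1 : 1 ≤ Ring.ordFrac (S.presheaf.stalk z) f := (Scheme.le_ord_iff hz hf).mp h
  -- The order is the inverse of the multiplicative valuation, so the inequality flips.
  rw [Ring.ordFrac_eq_valuation_inv] at h1
  refine IsDiscreteValuationRing.exists_lift_of_le_one ?_
  exact (one_le_inv₀ (by simpa [zero_lt_iff] using hf)).mp h1

theorem ord_nonneg_of_isRegularAt {f : S.functionField} (hf : f ≠ 0) {z : S}
    (h : IsRegularAt f z) : 0 ≤ Scheme.ord f z := by
  by_cases hz : Order.coheight z = 1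
  · obtain ⟨g, rfl⟩ := h
    have : Ring.KrullDimLE 1 (S.presheaf.stalk z) := krullDimLE_of_coheight_le hz.le
    exact (Scheme.le_ord_iff hz hf).mpr
      (Ring.ordFrac_ge_one_of_ne_zero fun h ↦ hf (by rw [h, map_zero]))
  · rw [Scheme.ord_eq_zero_of_coheight_neq_one hz]

/-- In a discrete valuation ring, order zero means unit. This gives sections vanishing on `Z` order
at least one along each of its components. -/
theorem ord_pos_of_mem_maximalIdeal {z : S} (hz : Order.coheight z = 1)
    [IsIntegrallyClosed (S.presheaf.stalk z)] {g : S.presheaf.stalk z} (hg : g ≠ 0)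
    (hgm : g ∈ IsLocalRing.maximalIdeal (S.presheaf.stalk z)) :
    0 < Scheme.ord (algebraMap (S.presheaf.stalk z) S.functionField g) z := by
  have hf : algebraMap (S.presheaf.stalk z) S.functionField g ≠ 0 :=
    (map_ne_zero_iff _ (IsFractionRing.injective _ _)).mpr hg
  refine lt_of_le_of_ne (ord_nonneg_of_isRegularAt hf ⟨g, rfl⟩) fun h ↦ ?_
  have := isDiscreteValuationRing_stalk z hz
  have h1 := (Scheme.ord_eq_iff hz hf).mp h.symm
  exact (IsLocalRing.mem_maximalIdeal g).mp hgm
    ((Ring.isUnit_iff_ordFrac_one_of_isDiscreteValuationRing (K := S.functionField)).mpr h1)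

/-- On a locally Noetherian normal integral scheme, a rational function whose divisor is effective
near `x` is regular at `x`. -/
theorem isRegularAt_of_forall_ord_nonneg {f : S.functionField} (hf : f ≠ 0) {U : S.Opens}
    (hU : IsAffineOpen U) [Nonempty U] [IsIntegrallyClosed Γ(S, U)] (x : U)
    (h : ∀ z : S, Order.coheight z = 1 → z ⤳ x.1 → 0 ≤ Scheme.ord f z) : IsRegularAt f x.1 := by
  have := functionField_isFractionRing_of_isAffineOpen S U hU
  have : IsNoetherianRing Γ(S, U) := IsLocallyNoetherian.component_noetherian ⟨U, hU⟩
  rw [isRegularAt_iff_denominators hU]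
  refine exists_notMem_denominators_of_height_one _ f fun q hq hq1 hqx ↦ ?_
  let z : U := ⟨hU.fromSpec ⟨q, hq⟩, hU.range_fromSpec.le ⟨_, rfl⟩⟩
  have hzq : (hU.primeIdealOf z).asIdeal = q := by
    have : hU.primeIdealOf z = ⟨q, hq⟩ := by
      apply hU.fromSpec.isOpenEmbedding.injective
      exact hU.fromSpec_primeIdealOf z
    rw [this]
  have hz1 : Order.coheight z.1 = 1 := by
    have := height_primeIdealOf hU z
    rw [hzq, hq1] at this
    exact_mod_cast this.symm
  have hzx : z.1 ⤳ x.1 := by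
    rw [← hU.fromSpec_primeIdealOf x]
    exact ((PrimeSpectrum.le_iff_specializes _ _).mp hqx).map hU.fromSpec.continuous
  have := isIntegrallyClosed_stalk_of_isAffineOpen hU z
  rw [← hzq]
  exact (isRegularAt_iff_denominators hU z f).mp (isRegularAt_of_ord_nonneg hf hz1 (h z hz1 hzx))

theorem ord_inv {f : S.functionField} (hf : f ≠ 0) (z : S) :
    Scheme.ord f⁻¹ z = -Scheme.ord f z := by
  have h1 := Scheme.ord_mul (x := z) (one_ne_zero (α := S.functionField)) one_ne_zero
  have h2 := Scheme.ord_mul (x := z) hf (inv_ne_zero hf)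
  rw [mul_inv_cancel₀ hf] at h2
  rw [mul_one] at h1
  linarith

theorem ord_pow {f : S.functionField} (hf : f ≠ 0) (z : S) (n : ℕ) :
    Scheme.ord (f ^ n) z = n * Scheme.ord f z := by
  induction n with
  | zero =>
    have h1 := Scheme.ord_mul (x := z) (one_ne_zero (α := S.functionField)) one_ne_zero
    rw [mul_one] at h1
    rw [pow_zero, Nat.cast_zero, zero_mul]
    linarith
  | succ n ih =>
    rw [pow_succ, Scheme.ord_mul (pow_ne_zero n hf) hf, ih]
    push_cast
    ring

/-- Only finitely many components of the divisor of a non-zero rational function pass through a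
given point. -/
theorem finite_divComponents_specializes {f : S.functionField} (hf : f ≠ 0) (x : S) :
    {z | z ∈ divComponents f ∧ z ⤳ x}.Finite := by
  obtain ⟨_, ⟨U, hU, rfl⟩, hxU, -⟩ :=
    S.isBasis_affineOpens.exists_subset_of_mem_open (Set.mem_univ x) isOpen_univ
  have : Nonempty U := ⟨⟨x, hxU⟩⟩
  have := functionField_isFractionRing_of_isAffineOpen S U hU
  have : IsNoetherianRing Γ(S, U) := IsLocallyNoetherian.component_noetherian ⟨U, hU⟩
  obtain ⟨a, b, hb, rfl⟩ := IsFractionRing.div_surjective (A := Γ(S, U)) f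
  have hb0 : b ≠ 0 := nonZeroDivisors.ne_zero hb
  have ha0 : a ≠ 0 := by
    rintro rfl
    simp at hf
  -- With `f = a / b`, each component through `x` is a height-one prime containing `a` or `b`, hence
  -- minimal over `(a)` or `(b)`; otherwise `f` and `f⁻¹` are both regular there and the order is
  -- zero.
  have hfin : ((Ideal.span {a}).minimalPrimes ∪ (Ideal.span {b}).minimalPrimes).Finite :=
    (Ideal.finite_minimalPrimes_of_isNoetherianRing _ _).union
      (Ideal.finite_minimalPrimes_of_isNoetherianRing _ _)
  have hinj : Function.Injective (PrimeSpectrum.asIdeal (R := Γ(S, U))) :=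
    fun _ _ ↦ PrimeSpectrum.ext
  refine ((hfin.preimage hinj.injOn).image hU.fromSpec).subset ?_
  rintro z ⟨⟨hz, hord⟩, hzx⟩
  let z' : U := ⟨z, hzx.mem_open U.isOpen hxU⟩
  have hht : (hU.primeIdealOf z').asIdeal.height = 1 := by
    have := height_primeIdealOf hU z'
    rw [hz] at this
    exact_mod_cast this
  have hmin (c : Γ(S, U)) (hc : c ≠ 0) (hcz : c ∈ (hU.primeIdealOf z').asIdeal) :
      (hU.primeIdealOf z').asIdeal ∈ (Ideal.span {c}).minimalPrimes :=
    Ideal.mem_minimalPrimes_of_height_le ((Ideal.span_singleton_le_iff_mem _).mpr hcz)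
      (hht.trans_le (Ideal.one_le_height_span_singleton_of_mem_nonZeroDivisors
        (mem_nonZeroDivisors_of_ne_zero hc)))
  refine ⟨hU.primeIdealOf z', ?_, hU.fromSpec_primeIdealOf z'⟩
  by_contra hcon
  have haz : a ∉ (hU.primeIdealOf z').asIdeal := fun h ↦ hcon (Or.inl (hmin a ha0 h))
  have hbz : b ∉ (hU.primeIdealOf z').asIdeal := fun h ↦ hcon (Or.inr (hmin b hb0 h))
  have haK := IsFractionRing.to_map_ne_zero_of_mem_nonZeroDivisors (K := S.functionField)
    (mem_nonZeroDivisors_of_ne_zero ha0)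
  have hbK := IsFractionRing.to_map_ne_zero_of_mem_nonZeroDivisors (K := S.functionField) hb
  have h1 := ord_nonneg_of_isRegularAt hf ((isRegularAt_iff_denominators hU z' _).mpr
    ⟨b, hbz, Ideal.mem_denominators.mpr ⟨a, (mul_div_cancel₀ _ hbK).symm⟩⟩)
  have h2 := ord_nonneg_of_isRegularAt (inv_ne_zero hf) ((isRegularAt_iff_denominators hU z' _).mpr
    ⟨a, haz, Ideal.mem_denominators.mpr ⟨b, by rw [inv_div, mul_div_cancel₀ _ haK]⟩⟩)
  rw [ord_inv hf] at h2
  exact hord (le_antisymm (by linarith) h1)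

end IntegralScheme
end DivisorReduction
-- Pullbacks, and valuations on the spectrum of a Dedekind domain.
namespace DivisorReduction

theorem map_genericPoint_specializes {X S : Scheme.{u}} [IsIntegral X] (j : X ⟶ S) (y : X) :
    j (genericPoint X) ⤳ j y :=
  ((genericPoint_spec X).specializes trivial).map j.continuous

section Pullback

variable {S : Scheme.{u}} [IsIntegral S]

theorem algebraMap_stalkSpecializes {x y : S} (h : y ⤳ x) (r : S.presheaf.stalk x) :
    algebraMap (S.presheaf.stalk y) S.functionField (S.presheaf.stalkSpecializes h r) =
      algebraMap (S.presheaf.stalk x) S.functionField r := by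
  simp only [RingHom.algebraMap_toAlgebra]
  rw [← S.presheaf.stalkSpecializes_comp ((genericPoint_spec S).specializes trivial) h]
  rfl

theorem IsRegularAt.of_specializes {f : S.functionField} {x y : S} (h : y ⤳ x)
    (hx : IsRegularAt f x) : IsRegularAt f y := by
  obtain ⟨r, rfl⟩ := hx
  exact ⟨_, algebraMap_stalkSpecializes h r⟩

theorem IsRegularAt.mul {f g : S.functionField} {x : S} (hf : IsRegularAt f x)
    (hg : IsRegularAt g x) : IsRegularAt (f * g) x := by
  obtain ⟨r, rfl⟩ := hf
  obtain ⟨s, rfl⟩ := hg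
  exact ⟨r * s, map_mul _ _ _⟩

theorem isRegularAt_algebraMap {x : S} (r : S.presheaf.stalk x) :
    IsRegularAt (algebraMap (S.presheaf.stalk x) S.functionField r) x := ⟨r, rfl⟩

variable {X : Scheme.{u}} [IsIntegral X] (j : X ⟶ S)

theorem pullbackFunction_mul {f g : S.functionField} (hf : IsRegularAt f (j (genericPoint X)))
    (hg : IsRegularAt g (j (genericPoint X))) :
    pullbackFunction j (f * g) (hf.mul hg) = pullbackFunction j f hf * pullbackFunction j g hg := by
  obtain ⟨r, rfl⟩ := id hf
  obtain ⟨s, rfl⟩ := id hg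
  rw [pullbackFunction_eq j _ hf r rfl, pullbackFunction_eq j _ hg s rfl,
    pullbackFunction_eq j _ (hf.mul hg) (r * s) (map_mul _ _ _), map_mul]

/-- The pullback of a function that is regular at `j y` is regular at `y`. -/
theorem pullbackFunction_algebraMap (y : X) (r : S.presheaf.stalk (j y)) :
    pullbackFunction j (algebraMap (S.presheaf.stalk (j y)) S.functionField r)
        ((isRegularAt_algebraMap r).of_specializes (map_genericPoint_specializes j y)) =
      algebraMap (X.presheaf.stalk y) X.functionField (j.stalkMap y r) := by
  rw [pullbackFunction_eq j _ _ _
    (algebraMap_stalkSpecializes (map_genericPoint_specializes j y) r)]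
  exact congr($(Scheme.Hom.stalkSpecializes_stalkMap j (genericPoint X) y
    ((genericPoint_spec X).specializes trivial)).hom r)

end Pullback

/-- The map from a ring to the local ring of its spectrum at a point. -/
noncomputable def toStalkHom (A : Type u) [CommRing A] (y : Spec (CommRingCat.of A)) :
    A →+* (Spec (CommRingCat.of A)).presheaf.stalk y :=
  (StructureSheaf.toStalk A y).hom

theorem isUnit_toStalkHom {B : Type u} [CommRing B] (y : Spec (CommRingCat.of B))
    {s : B} (hs : s ∉ y.asIdeal) :
    IsUnit (toStalkHom B y s) := by
  have key (q : PrimeSpectrum B) (hq : s ∈ q.asIdeal.primeCompl) :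
      IsUnit (algebraMap B ((Spec.structureSheaf B).presheaf.stalk q) s) :=
    IsLocalization.map_units _ (⟨s, hq⟩ : q.asIdeal.primeCompl)
  exact key y hs

theorem exists_mul_toStalkHom_eq {B : Type u} [CommRing B] (y : Spec (CommRingCat.of B))
    (β : (Spec (CommRingCat.of B)).presheaf.stalk y) :
    ∃ b : B, ∃ s ∉ y.asIdeal, β * toStalkHom B y s = toStalkHom B y b := by
  have key (q : PrimeSpectrum B) (t : (Spec.structureSheaf B).presheaf.stalk q) :
      ∃ b : B, ∃ s ∉ q.asIdeal, t * algebraMap B _ s = algebraMap B _ b := by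
    obtain ⟨⟨b, s⟩, hbs⟩ := IsLocalization.surj q.asIdeal.primeCompl t
    exact ⟨b, s, s.2, hbs⟩
  exact key y β

section Valuation

variable {B : Type u} [CommRing B] [IsDedekindDomain B]

theorem algebraMap_toStalkHom (y : Spec (CommRingCat.of B)) (b : B) :
    algebraMap ((Spec (CommRingCat.of B)).presheaf.stalk y) (Spec (CommRingCat.of B)).functionField
        (toStalkHom B y b) =
      algebraMap B (Spec (CommRingCat.of B)).functionField b :=
  congr($(StructureSheaf.toStalk_stalkSpecializes
    ((genericPoint_spec (Spec (CommRingCat.of B))).specializes (Set.mem_univ y))).hom b)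

variable (p : IsDedekindDomain.HeightOneSpectrum B)

theorem valuation_algebraMap_stalk {y : Spec (CommRingCat.of B)} (hy : y.asIdeal = p.asIdeal)
    {β : (Spec (CommRingCat.of B)).presheaf.stalk y} {b s : B} (hs : s ∉ y.asIdeal)
    (h : β * toStalkHom B y s = toStalkHom B y b) :
    p.valuation (Spec (CommRingCat.of B)).functionField
      (algebraMap ((Spec (CommRingCat.of B)).presheaf.stalk y)
        (Spec (CommRingCat.of B)).functionField β) = p.intValuation b := by
  have h1 := congr_arg (fun t ↦ p.valuation (Spec (CommRingCat.of B)).functionField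
    (algebraMap ((Spec (CommRingCat.of B)).presheaf.stalk y)
        (Spec (CommRingCat.of B)).functionField t)) h
  simp only [map_mul] at h1
  rw [algebraMap_toStalkHom, algebraMap_toStalkHom,
    IsDedekindDomain.HeightOneSpectrum.valuation_of_algebraMap,
    IsDedekindDomain.HeightOneSpectrum.valuation_of_algebraMap,
    IsDedekindDomain.HeightOneSpectrum.intValuation_eq_one_iff.mpr (hy ▸ hs), mul_one] at h1
  exact h1

theorem valuation_algebraMap_stalk_le_one {y : Spec (CommRingCat.of B)} (hy : y.asIdeal = p.asIdeal)
    (β : (Spec (CommRingCat.of B)).presheaf.stalk y) :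
    p.valuation (Spec (CommRingCat.of B)).functionField
      (algebraMap ((Spec (CommRingCat.of B)).presheaf.stalk y)
        (Spec (CommRingCat.of B)).functionField β) ≤ 1 := by
  obtain ⟨b, s, hs, h⟩ := exists_mul_toStalkHom_eq y β
  rw [valuation_algebraMap_stalk p hy hs h]
  exact p.intValuation_le_one b

/-- Passage from valuations to congruences: with `β = b / s` and `s` outside `p`, the bound says `b
∈ p ^ n`. -/
theorem stalkMap_specQuotient_eq_zero (n : ℕ) (w : Spec (CommRingCat.of (B ⧸ p.asIdeal ^ n)))
    (hy : (specQuotient (p.asIdeal ^ n) w).asIdeal = p.asIdeal)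
    (β : (Spec (CommRingCat.of B)).presheaf.stalk (specQuotient (p.asIdeal ^ n) w))
    (hβ : p.valuation (Spec (CommRingCat.of B)).functionField
      (algebraMap ((Spec (CommRingCat.of B)).presheaf.stalk (specQuotient (p.asIdeal ^ n) w))
        (Spec (CommRingCat.of B)).functionField β) ≤ WithZero.exp (-(n : ℤ))) :
    (specQuotient (p.asIdeal ^ n)).stalkMap w β = 0 := by
  obtain ⟨b, s, hs, h⟩ := exists_mul_toStalkHom_eq _ β
  rw [valuation_algebraMap_stalk p hy hs h,
    IsDedekindDomain.HeightOneSpectrum.intValuation_le_pow_iff_mem] at hβ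
  have key (c : B) : (specQuotient (p.asIdeal ^ n)).stalkMap w
      (toStalkHom B (specQuotient (p.asIdeal ^ n) w) c) =
      toStalkHom (B ⧸ p.asIdeal ^ n) w (Ideal.Quotient.mk (p.asIdeal ^ n) c) :=
    congr($(stalkMap_toStalk (CommRingCat.ofHom (Ideal.Quotient.mk (p.asIdeal ^ n))) w).hom c)
  have h1 := congr_arg ((specQuotient (p.asIdeal ^ n)).stalkMap w) h
  rw [map_mul, key b, Ideal.Quotient.eq_zero_iff_mem.mpr hβ, map_zero] at h1
  refine (IsUnit.mul_left_eq_zero ?_).mp h1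
  exact (isUnit_toStalkHom _ hs).map _

theorem specQuotient_asIdeal (n : ℕ) (w : Spec (CommRingCat.of (B ⧸ p.asIdeal ^ n))) :
    (specQuotient (p.asIdeal ^ n) w).asIdeal = p.asIdeal := by
  have h : p.asIdeal ^ n ≤ (specQuotient (p.asIdeal ^ n) w).asIdeal := fun b hb ↦ by
    change Ideal.Quotient.mk _ b ∈ w.asIdeal
    rw [Ideal.Quotient.eq_zero_iff_mem.mpr hb]
    exact w.asIdeal.zero_mem
  have hprime := (specQuotient (p.asIdeal ^ n) w).isPrime
  exact (p.isMaximal.eq_of_le hprime.ne_top (hprime.le_of_pow_le h)).symm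

/-- Additively, `n * k ≥ α` forces `k ≥ ⌈α / n⌉` because `k` is an integer; `v = 0` is infinite
order. -/
theorem le_exp_neg_ceil_of_pow_le {v : WithZero (Multiplicative ℤ)} {n α : ℕ} (hn : 0 < n)
    (h : v ^ n ≤ WithZero.exp (-(α : ℤ))) :
    v ≤ WithZero.exp (-((⌈(α : ℚ) / (n : ℚ)⌉₊ : ℕ) : ℤ)) := by
  by_cases hv : v = 0
  · simp [hv]
  obtain ⟨m, rfl⟩ : ∃ m : ℤ, v = WithZero.exp m := ⟨_, (WithZero.exp_log hv).symm⟩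
  rw [← WithZero.exp_nsmul, WithZero.exp_le_exp, nsmul_eq_mul] at h
  rw [WithZero.exp_le_exp]
  have hm : m ≤ 0 := by
    by_contra! hm
    have : (0 : ℤ) < n * m := by positivity
    omega
  obtain ⟨k, rfl⟩ : ∃ k : ℕ, m = -k := ⟨m.natAbs, by omega⟩
  have : ⌈(α : ℚ) / (n : ℚ)⌉₊ ≤ k := by
    rw [Nat.ceil_le, div_le_iff₀ (by positivity)]
    have : (α : ℤ) ≤ k * n := by linarith
    exact_mod_cast this
  omega

end Valuation
end DivisorReduction
-- Vanishing of the ideal of `Z` modulo the prime power.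
namespace DivisorReduction

/-- If the pullback of `f` has valuation `α`, then the pullback of a multiple of `f` in the local
ring has valuation at least `α`. -/
theorem valuation_pullback_le {S : Scheme.{u}} [IsIntegral S] {B : Type u} [CommRing B]
    [IsDedekindDomain B] (j : Spec (CommRingCat.of B) ⟶ S) {f : S.functionField}
    (hreg : IsRegularAt f (j (genericPoint (Spec (CommRingCat.of B)))))
    (p : IsDedekindDomain.HeightOneSpectrum B) {α : ℕ}
    (hval : p.valuation (Spec (CommRingCat.of B)).functionField (pullbackFunction j f hreg) =
      WithZero.exp (-(α : ℤ)))
    {y : Spec (CommRingCat.of B)} (hy : y.asIdeal = p.asIdeal)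
    {σ : S.presheaf.stalk (j y)} {g : S.functionField} (hg : IsRegularAt g (j y))
    (h : algebraMap (S.presheaf.stalk (j y)) S.functionField σ = f * g) :
    p.valuation (Spec (CommRingCat.of B)).functionField
      (algebraMap ((Spec (CommRingCat.of B)).presheaf.stalk y)
        (Spec (CommRingCat.of B)).functionField (j.stalkMap y σ)) ≤ WithZero.exp (-(α : ℤ)) := by
  obtain ⟨r, rfl⟩ := hg
  have hr := (isRegularAt_algebraMap r).of_specializes (map_genericPoint_specializes j y)
  have h1 := pullbackFunction_mul j hreg hr
  have h2 := pullbackFunction_algebraMap j y σ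
  simp only [h] at h2
  rw [← h2, h1, map_mul, hval, pullbackFunction_algebraMap]
  exact mul_le_of_le_one_right' (valuation_algebraMap_stalk_le_one p hy _)

section Normal

variable {S : Scheme.{u}} [IsIntegral S] [IsLocallyNoetherian S]
  (hnormal : ∀ U : S.Opens, IsAffineOpen U → Nonempty U → IsIntegrallyClosed Γ(S, U))

include hnormal in
theorem isRegularAt_of_forall_specializes {f : S.functionField} (hf : f ≠ 0) (x : S)
    (h : ∀ z : S, Order.coheight z = 1 → z ⤳ x → 0 ≤ Scheme.ord f z) : IsRegularAt f x := by
  obtain ⟨_, ⟨U, hU, rfl⟩, hxU, -⟩ :=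
    S.isBasis_affineOpens.exists_subset_of_mem_open (Set.mem_univ x) isOpen_univ
  have : Nonempty U := ⟨⟨x, hxU⟩⟩
  have := hnormal U hU this
  exact isRegularAt_of_forall_ord_nonneg hf hU ⟨x, hxU⟩ h

-- A polar component through the image of the generic point would contain every specialization of
-- it, hence all of the image.
include hnormal in
theorem isRegularAt_genericPoint {X : Scheme.{u}} [IsIntegral X] (j : X ⟶ S)
    {f : S.functionField} (hf : f ≠ 0) (hproper : DivMeetsProperly f j) :
    IsRegularAt f (j (genericPoint X)) := by
  refine isRegularAt_of_forall_specializes hnormal hf _ fun z hz hzx ↦ ?_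
  by_contra hneg
  refine hproper z ⟨hz, fun h ↦ hneg h.ge⟩ ?_
  rintro _ ⟨y, rfl⟩
  exact specializes_iff_mem_closure.mp (hzx.trans (map_genericPoint_specializes j y))

theorem finite_multiplicitiesAt {f : S.functionField} (hf : f ≠ 0) (x : S) :
    (multiplicitiesAt f x).Finite := by
  refine ((finite_divComponents_specializes hf x).image (Scheme.ord f)).subset ?_
  rintro _ ⟨z, hz, hzx, rfl⟩
  exact ⟨z, ⟨hz, specializes_iff_mem_closure.mpr hzx⟩, rfl⟩

include hnormal in
/-- A section vanishing on the support of the divisor of zeros, raised to the largest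
multiplicity at `x`, is divisible by the rational function in the local ring at `x`. -/
theorem isRegularAt_pow_mul_inv {f : S.functionField} (hf : f ≠ 0) {U : S.affineOpens}
    {x : S} (hxU : x ∈ U.1) {n : ℕ} (hn : ∀ m ∈ multiplicitiesAt f x, m ≤ n)
    {s : Γ(S, U)} (hs : s ∈ (zeroDivisorIdeal f).ideal U)
    (hs0 : S.presheaf.germ U x hxU s ≠ 0) :
    IsRegularAt (algebraMap (S.presheaf.stalk x) S.functionField (S.presheaf.germ U x hxU s) ^ n *
      f⁻¹) x := by
  have hU := U.2
  have hne : Nonempty U.1 := ⟨⟨x, hxU⟩⟩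
  have := hnormal U hU hne
  set σ := algebraMap (S.presheaf.stalk x) S.functionField (S.presheaf.germ U x hxU s) with hσ
  have hσ0 : σ ≠ 0 := (map_ne_zero_iff _ (IsFractionRing.injective _ _)).mpr hs0
  refine isRegularAt_of_forall_specializes hnormal
    (mul_ne_zero (pow_ne_zero n hσ0) (inv_ne_zero hf)) x fun z hz hzx ↦ ?_
  have hσreg : 0 ≤ Scheme.ord σ z :=
    ord_nonneg_of_isRegularAt hσ0 ((isRegularAt_algebraMap _).of_specializes hzx)
  rw [Scheme.ord_mul (pow_ne_zero n hσ0) (inv_ne_zero hf), ord_inv hf, ord_pow hσ0]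
  -- Only zero components can lower the order of `σ ^ n / f`; there `σ` has order at least one and
  -- `ord f z ≤ n`.
  by_cases hpos : Scheme.ord f z ≤ 0
  · have : 0 ≤ (n : ℤ) * Scheme.ord σ z := by positivity
    linarith
  push Not at hpos
  have hcomp : z ∈ divComponents f := ⟨hz, hpos.ne'⟩
  have hle : Scheme.ord f z ≤ n :=
    hn _ ⟨z, hcomp, specializes_iff_mem_closure.mp hzx, rfl⟩
  let z' : U.1 := ⟨z, hzx.mem_open U.1.isOpen hxU⟩
  have hnz := isIntegrallyClosed_stalk_of_isAffineOpen hU z'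
  have hσz : σ = algebraMap (S.presheaf.stalk z) S.functionField
      (S.presheaf.germ U z z'.2 s) := by
    rw [hσ, Scheme.algebraMap_germ_eq_germToFunctionField,
      Scheme.algebraMap_germ_eq_germToFunctionField]
  have hmem : s ∈ (hU.primeIdealOf z').asIdeal := by
    rw [zeroDivisorIdeal, Scheme.IdealSheafData.vanishingIdeal_ideal] at hs
    refine (PrimeSpectrum.mem_vanishingIdeal _ _).mp hs _ ?_
    change hU.fromSpec (hU.primeIdealOf z') ∈ (zeroDivisorSupport f : Set S)
    rw [hU.fromSpec_primeIdealOf z']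
    exact subset_closure ⟨hcomp, hpos⟩
  have hmax : S.presheaf.germ U z z'.2 s ∈ IsLocalRing.maximalIdeal (S.presheaf.stalk z) := by
    have := hU.isLocalization_stalk z'
    let _ := TopCat.Presheaf.algebra_section_stalk S.presheaf z'
    exact (IsLocalization.AtPrime.to_map_mem_maximal_iff (S.presheaf.stalk z)
      (hU.primeIdealOf z').asIdeal s).mpr hmem
  have hpos' : 0 < Scheme.ord σ z := by
    rw [hσz]
    refine ord_pos_of_mem_maximalIdeal hz (fun h ↦ hσ0 ?_) hmax
    rw [hσz, h, map_zero]
  have : (n : ℤ) * 1 ≤ n * Scheme.ord σ z := by gcongr; omega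
  linarith

variable {B : Type u} [CommRing B] [IsDedekindDomain B] (j : Spec (CommRingCat.of B) ⟶ S)
  {f : S.functionField} (hf : f ≠ 0)
  (hreg : IsRegularAt f (j (genericPoint (Spec (CommRingCat.of B)))))
  (p : IsDedekindDomain.HeightOneSpectrum B) {α : ℕ}
  (hval : p.valuation (Spec (CommRingCat.of B)).functionField (pullbackFunction j f hreg) =
    WithZero.exp (-(α : ℤ)))

include hnormal hf hval in
theorem exists_isGreatest_multiplicitiesAt (hα : 0 < α) {y : Spec (CommRingCat.of B)}
    (hy : y.asIdeal = p.asIdeal) :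
    ∃ n : ℕ, 0 < n ∧ IsGreatest (multiplicitiesAt f (j y)) (n : ℤ) := by
  obtain ⟨m, hm, hmpos⟩ : ∃ m ∈ multiplicitiesAt f (j y), 0 < m := by
    by_contra! hcon
    have hinv : IsRegularAt f⁻¹ (j y) := by
      refine isRegularAt_of_forall_specializes hnormal (inv_ne_zero hf) _ fun z hz hzx ↦ ?_
      rw [ord_inv hf]
      by_contra! hneg
      exact (hcon _ ⟨z, ⟨hz, by omega⟩, specializes_iff_mem_closure.mp hzx, rfl⟩).not_gt
        (by omega)
    -- Writing `1 = f * f⁻¹` with `f⁻¹` regular would give `1` valuation at least `α > 0`.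
    have h := valuation_pullback_le j hreg p hval hy (σ := 1) hinv
      (by rw [map_one, mul_inv_cancel₀ hf])
    rw [map_one, map_one, map_one, ← WithZero.exp_zero, WithZero.exp_le_exp] at h
    omega
  obtain ⟨d, hd, hmax⟩ := (finite_multiplicitiesAt hf (j y)).exists_maximalFor id _ ⟨m, hm⟩
  have hgreatest : ∀ m ∈ multiplicitiesAt f (j y), m ≤ d := fun m hm ↦ by
    by_contra! hlt
    exact hlt.not_ge (hmax hm hlt.le)
  obtain ⟨n, rfl⟩ := Int.eq_ofNat_of_zero_le (hmpos.le.trans (hgreatest m hm))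
  exact ⟨n, by exact_mod_cast hmpos.trans_le (hgreatest m hm), hd, hgreatest⟩

include hnormal hf hval in
theorem zeroDivisorIdeal_le_ker {n : ℕ} (hn : 0 < n)
    (hmax : ∀ m ∈ multiplicitiesAt f (j (⟨p.asIdeal, p.isPrime⟩ : PrimeSpectrum B)), m ≤ n) :
    zeroDivisorIdeal f ≤ (specQuotient (p.asIdeal ^ ⌈(α : ℚ) / (n : ℚ)⌉₊) ≫ j).ker := by
  set a := ⌈(α : ℚ) / (n : ℚ)⌉₊
  refine Scheme.IdealSheafData.le_ofIdeals_iff.mpr fun U s hs ↦ ?_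
  rw [RingHom.mem_ker]
  refine TopCat.Presheaf.section_ext (Spec (CommRingCat.of (B ⧸ p.asIdeal ^ a))).sheaf _ _ _
    fun w hw ↦ ?_
  have hy := specQuotient_asIdeal p a w
  have hyp : specQuotient (p.asIdeal ^ a) w = (⟨p.asIdeal, p.isPrime⟩ : PrimeSpectrum B) :=
    PrimeSpectrum.ext hy
  rw [← hyp] at hmax
  have hxU : j (specQuotient (p.asIdeal ^ a) w) ∈ U.1 := hw
  have hgerm : (Spec (CommRingCat.of (B ⧸ p.asIdeal ^ a))).presheaf.germ _ w hw
      ((specQuotient (p.asIdeal ^ a) ≫ j).app U s) =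
      (specQuotient (p.asIdeal ^ a)).stalkMap w (j.stalkMap (specQuotient (p.asIdeal ^ a) w)
        (S.presheaf.germ U _ hxU s)) := by
    rw [← Scheme.Hom.germ_stalkMap_apply (specQuotient (p.asIdeal ^ a) ≫ j) U.1 w hw,
      Scheme.Hom.stalkMap_comp]
    rfl
  have hzero : (specQuotient (p.asIdeal ^ a)).stalkMap w
      (j.stalkMap (specQuotient (p.asIdeal ^ a) w) (S.presheaf.germ U _ hxU s)) = 0 := by
    -- The zero germ is set aside because orders are additive only on nonzero functions.
    by_cases hs0 : S.presheaf.germ U _ hxU s = 0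
    · rw [hs0, map_zero, map_zero]
    refine stalkMap_specQuotient_eq_zero p a w hy _ (le_exp_neg_ceil_of_pow_le hn ?_)
    rw [← map_pow, ← map_pow, ← map_pow]
    refine valuation_pullback_le j hreg p hval hy
      (isRegularAt_pow_mul_inv hnormal hf hxU hmax hs hs0) ?_
    rw [map_pow, mul_comm, inv_mul_cancel_right₀ hf]
  exact (hgerm.trans hzero).trans
    (map_zero ((Spec (CommRingCat.of (B ⧸ p.asIdeal ^ a))).presheaf.germ _ w hw).hom).symm

end Normal
end DivisorReduction

open DivisorReduction in
theorem mainTheorem9 {R B : Type u}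
    [CommRing R] [IsDedekindDomain R] [CharZero R]
    [CommRing B] [IsDedekindDomain B]
    [Algebra R B] (hRB : Function.Injective (algebraMap R B))
    (S : Scheme.{u}) [IsIntegral S]
    (π : S ⟶ Spec (CommRingCat.of R)) [Smooth π] [QuasiCompact π]
    (ι : Spec (CommRingCat.of B) ⟶ S)
    (hι : ι ≫ π = Spec.map (CommRingCat.ofHom (algebraMap R B)))
    (f : S.functionField) (hf : f ≠ 0)
    (hproper : haveI := isLocallyNoetherian_of_smooth π; DivMeetsProperly f ι) :
    haveI := isLocallyNoetherian_of_smooth π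
    ∃ hreg : IsRegularAt f (ι (genericPoint (Spec (CommRingCat.of B)))),
      ∀ (p : IsDedekindDomain.HeightOneSpectrum B) (α : ℕ), 0 < α →
        p.valuation (Spec (CommRingCat.of B)).functionField (pullbackFunction ι f hreg) =
          WithZero.exp (-(α : ℤ)) →
        ∃ d : ℤ,
          IsGreatest (multiplicitiesAt f (ι (⟨p.asIdeal, p.isPrime⟩ : PrimeSpectrum B))) d ∧
          0 < d ∧
          0 < ⌈(α : ℚ) / (d : ℚ)⌉₊ ∧
          ∃ g : Spec (CommRingCat.of (B ⧸ p.asIdeal ^ ⌈(α : ℚ) / (d : ℚ)⌉₊)) ⟶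
              (zeroDivisorIdeal f).subscheme,
            g ≫ (zeroDivisorIdeal f).subschemeι =
              specQuotient (p.asIdeal ^ ⌈(α : ℚ) / (d : ℚ)⌉₊) ≫ ι := by
  have := isLocallyNoetherian_of_smooth π
  have hnormal (U : S.Opens) (hU : IsAffineOpen U) (_ : Nonempty U) :
      IsIntegrallyClosed Γ(S, U) := isIntegrallyClosed_of_smooth π hU
  refine ⟨isRegularAt_genericPoint hnormal ι hf hproper, fun p α hα hval ↦ ?_⟩
  obtain ⟨n, hn, hgreatest⟩ := exists_isGreatest_multiplicitiesAt hnormal ι hf _ p hval hα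
    (y := (⟨p.asIdeal, p.isPrime⟩ : PrimeSpectrum B)) rfl
  refine ⟨n, hgreatest, by exact_mod_cast hn, Nat.ceil_pos.mpr (by positivity), ?_⟩
  rw [Int.cast_natCast]
  have hker := zeroDivisorIdeal_le_ker hnormal ι hf _ p hval hn hgreatest.2
  -- A morphism factors through a closed immersion once its kernel contains the defining ideal.
  exact ⟨IsClosedImmersion.lift (zeroDivisorIdeal f).subschemeι _
    (by rwa [Scheme.IdealSheafData.ker_subschemeι]), IsClosedImmersion.lift_fac _ _ _⟩
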